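/- Let $A$ be a Borel space (a measurable space isomorphic to a Borel subset of $[0,1]$). For a word $\mathbf w=(w_1,\dots,w_n)\in A^n$ and $i\in[n]=\{1,\dots,n\}$ let $\mathrm{erase}(\mathbf w,i)\in A^{n-1}$ be the word obtained by deleting the $i$-th letter. A *general erased-word process* (GEWP) over $A$ is a stochastic process $(\mathbf W,\boldsymbol\eta)=(\mathbf W_n,\eta_n)_{n\ge 1}$ on a probability space $(\Omega,\mathcal A,\mathbb P)$ such that for every $n\ge 1$: (i) $\mathbf W_n$ is a random element of $A^n$; (ii) $\eta_n$ is uniform on $[n]$ and independent of $\mathcal F_n:=\sigma(\mathbf W_k,\eta_{k+1}:k\ge n)$; (iii) $\mathbf W_n=\mathrm{erase}(\mathbf W_{n+1},\eta_{n+1})$ almost surely. The sequence $(\mathcal F_n)_{n\ge1}$ is the backward filtration generated by the GEWP. The GEWP is *ergodic* if its law is an extreme point of the convex set of all laws of GEWPs over $A$ on $\prod_{n\ge 1}(A^n\times[n])$. The backward filtration is *generated by the eraser-process* $\boldsymbol\eta$ if, for every $n\ge 1$, $\mathcal F_n$ and $\sigma(\eta_k:k\ge n+1)$ are almost surely equal,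 i.e. every event of either $\sigma$-field differs from some event of the other only by a null set. Let $\mathcal C(A)$ be the set of probability measures $\rho$ on $A\times\mathbb R$ with $\rho(A\times[0,t])=t$ for all $t\in[0,1]$. For $\rho\in\mathcal C(A)$ let $(Y_j,U_j)_{j\ge1}$ be i.i.d. with law $\rho$, and let $\mathrm{GL}(\rho)$ be the law of the process $(\mathbf W_n,\eta_n)_{n\ge1}$ given by $\mathbf W_n=(Y_{\pi_n(1)},\dots,Y_{\pi_n(n)})$, where $\pi_n$ is the permutation of $[n]$ that sorts $U_1,\dots,U_n$ in increasing order (ties, which have probability zero, are broken by index), and $\eta_n=\#\{k\in[n]:U_k\le U_n\}$. **Proposition.** Let $(\mathbf W,\boldsymbol\eta)$ be an ergodic GEWP over $A$. Its backward filtration is generated by the eraser-process $\boldsymbol\eta$ if and only if the law of $(\mathbf W,\boldsymbol\eta)$ equals $\mathrm{GL}(\rho)$ for some $\rho\in\mathcal C(A)$ of the form $\rho=\mathrm{Law}(f(U),U)$, where $f:[0,1]\to A$ is measurable and $U$ is uniformly distributed on $[0,1]$. -/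

import Mathlib

open MeasureTheory ProbabilityTheory
open scoped NNReal ENNReal

namespace ErasedWord

/-! Times are shifted by one: the index `n : ℕ` stands for the time `n + 1`, so the word at index `n`
has the `n + 1` letters indexed by `Fin (n + 1)`, and the eraser at index `n` is a position in
`Fin (n + 1)`. -/

/-- The word obtained from `w` by erasing its letter at position `i`. -/
def erase {A : Type*} {n : ℕ} (w : Fin (n + 1) → A) (i : Fin (n + 1)) : Fin n → A :=
  fun j => w (i.succAbove j)

section Basics

variable {A Ω : Type*} [MeasurableSpace A] [MeasurableSpace Ω]

/-- The `n`-th `σ`-field of the backward filtration generated by a process `(W, η)`: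
it is generated by the words `W k` and the erasers `η (k + 1)`, for `k ≥ n`. -/
@[reducible]
def backwardFiltration (W : (n : ℕ) → Ω → (Fin (n + 1) → A)) (η : (n : ℕ) → Ω → Fin (n + 1))
    (n : ℕ) : MeasurableSpace Ω :=
  ⨆ k : ℕ, ⨆ _ : n ≤ k,
    MeasurableSpace.comap (W k) inferInstance ⊔ MeasurableSpace.comap (η (k + 1)) inferInstance

/-- The `σ`-field generated by the erasers `η k` with `k ≥ n + 1`. -/
@[reducible]
def eraserFuture (η : (n : ℕ) → Ω → Fin (n + 1)) (n : ℕ) : MeasurableSpace Ω :=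
  ⨆ k : ℕ, ⨆ _ : n + 1 ≤ k, MeasurableSpace.comap (η k) inferInstance

/-- `(W, η)` is a general erased-word process over `A`, under the measure `μ`. -/
structure IsGEWP (W : (n : ℕ) → Ω → (Fin (n + 1) → A)) (η : (n : ℕ) → Ω → Fin (n + 1))
    (μ : Measure Ω) : Prop where
  measurable_word : ∀ n, Measurable (W n)
  measurable_eraser : ∀ n, Measurable (η n)
  uniform : ∀ n, ∀ i : Fin (n + 1), μ {ω | η n ω = i} = ((n : ℝ≥0∞) + 1)⁻¹
  indep : ∀ n, Indep (MeasurableSpace.comap (η n) inferInstance) (backwardFiltration W η n) μ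
  erase_eq : ∀ n, ∀ᵐ ω ∂μ, W n ω = erase (W (n + 1) ω) (η (n + 1) ω)

/-- Almost sure inclusion of `σ`-fields. -/
def AESub {Ω : Type*} {m₀ : MeasurableSpace Ω} (μ : Measure[m₀] Ω) (m₁ m₂ : MeasurableSpace Ω) : Prop :=
  ∀ s, MeasurableSet[m₁] s → ∃ t, MeasurableSet[m₂] t ∧ μ (symmDiff s t) = 0

/-- Almost sure equality of `σ`-fields. -/
def AEEq {Ω : Type*} {m₀ : MeasurableSpace Ω} (μ : Measure[m₀] Ω) (m₁ m₂ : MeasurableSpace Ω) : Prop :=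
  AESub μ m₁ m₂ ∧ AESub μ m₂ m₁

/-- The backward filtration of `(W, η)` is generated by the eraser-process `η`. -/
def IsGeneratedByEraser (W : (n : ℕ) → Ω → (Fin (n + 1) → A)) (η : (n : ℕ) → Ω → Fin (n + 1))
    (μ : Measure Ω) : Prop :=
  ∀ n, AEEq μ (backwardFiltration W η n) (eraserFuture η n)

end Basics

/-- The space of trajectories of erased-word processes over `A`, with the product `σ`-field. -/
abbrev Path (A : Type*) : Type _ := (n : ℕ) → (Fin (n + 1) → A) × Fin (n + 1)

section Law

variable {A Ω : Type*} [MeasurableSpace A] [MeasurableSpace Ω]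

/-- The law of a process `(W, η)` on the space of trajectories. -/
noncomputable def law (W : (n : ℕ) → Ω → (Fin (n + 1) → A)) (η : (n : ℕ) → Ω → Fin (n + 1))
    (μ : Measure Ω) : Measure (Path A) :=
  μ.map (fun ω n => (W n ω, η n ω))

variable (A) in
/-- The set of laws of general erased-word processes over `A`: the probability measures on the
space of trajectories under which the coordinate process is a general erased-word process. -/
def gewpLaws : Set (Measure (Path A)) :=
  {P | IsProbabilityMeasure P ∧ IsGEWP (fun n (p : Path A) => (p n).1) (fun n p => (p n).2) P}

/-- The law of every general erased-word process over a Borel space belongs to `gewpLaws`. -/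
theorem IsGEWP.law_mem [StandardBorelSpace A]
    {W : (n : ℕ) → Ω → (Fin (n + 1) → A)} {η : (n : ℕ) → Ω → Fin (n + 1)}
    {μ : Measure Ω} [IsProbabilityMeasure μ] (h : IsGEWP W η μ) :
    law W η μ ∈ gewpLaws A := by
  have hm : Measurable (fun ω n => (W n ω, η n ω) : Ω → Path A) :=
    measurable_pi_lambda _ fun n => (h.measurable_word n).prodMk (h.measurable_eraser n)
  have h1 : ∀ n, Measurable fun p : Path A => (p n).1 := fun n => (measurable_pi_apply n).fst
  have h2 : ∀ n, Measurable fun p : Path A => (p n).2 := fun n => (measurable_pi_apply n).snd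
  have hle : ∀ n, backwardFiltration (fun n (p : Path A) => (p n).1) (fun n p => (p n).2) n ≤
      MeasurableSpace.pi := fun n =>
    iSup₂_le fun k _ => sup_le (h1 k).comap_le (h2 (k + 1)).comap_le
  refine ⟨Measure.isProbabilityMeasure_map hm.aemeasurable, h1, h2, fun n i => ?_, fun n => ?_,
    fun n => ?_⟩
  · exact (Measure.map_apply hm (h2 n (measurableSet_singleton i))).trans (h.uniform n i)
  · rw [Indep_iff]
    intro s t hs ht
    have hs' := (h2 n).comap_le s hs
    have ht' := hle n t ht
    rw [law, Measure.map_apply hm hs', Measure.map_apply hm ht',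
      Measure.map_apply hm (hs'.inter ht'), Set.preimage_inter]
    refine (Indep_iff _ _ μ).1 (h.indep n) _ _ ?_ ?_
    · obtain ⟨u, hu, rfl⟩ := hs
      exact ⟨u, hu, rfl⟩
    · have : MeasurableSpace.comap (fun ω n => (W n ω, η n ω) : Ω → Path A)
          (backwardFiltration (fun n (p : Path A) => (p n).1) (fun n p => (p n).2) n) =
          backwardFiltration W η n := by
        simp only [backwardFiltration, MeasurableSpace.comap_iSup, MeasurableSpace.comap_sup,
          MeasurableSpace.comap_comp]
        rfl
      rw [← this]
      exact ⟨t, ht, rfl⟩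
  · rw [law]
    refine (ae_map_iff hm.aemeasurable ?_).2 (h.erase_eq n)
    have : {p : Path A | (p n).1 = erase (p (n + 1)).1 (p (n + 1)).2} =
        ⋂ j : Fin (n + 1), ⋃ i : Fin (n + 2), {p : Path A | (p (n + 1)).2 = i} ∩
          {p | (p n).1 j = (p (n + 1)).1 (i.succAbove j)} := by
      ext p
      simp [erase, funext_iff]
    rw [this]
    let _ := upgradeStandardBorel A
    exact MeasurableSet.iInter fun j => MeasurableSet.iUnion fun i =>
      (h2 (n + 1) (measurableSet_singleton i)).inter
        (measurableSet_eq_fun ((measurable_pi_apply j).comp (h1 n))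
          ((measurable_pi_apply (i.succAbove j)).comp (h1 (n + 1))))

/-- `(W, η)` is an ergodic general erased-word process: its law is an extreme point of the convex
set of all laws of general erased-word processes over `A`. -/
def IsErgodicGEWP (W : (n : ℕ) → Ω → (Fin (n + 1) → A)) (η : (n : ℕ) → Ω → Fin (n + 1))
    (μ : Measure Ω) : Prop :=
  IsGEWP W η μ ∧ law W η μ ∈ (gewpLaws A).extremePoints ℝ≥0

end Law

section Representation

variable {A : Type*}

/-- The induced order statistics of `y 0, …, y n` with respect to `x 0, …, x n`: the letters `y`
are rearranged by the permutation that sorts the values of `x` increasingly (and stably). -/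
noncomputable def inducedOrderStatistics {n : ℕ} (y : Fin n → A) (x : Fin n → ℝ) : Fin n → A :=
  fun i => y (Tuple.sort x i)

/-- The position, counted from zero, of `x n` among `x 0, …, x n`; it is one less than the number
of `k ≤ n` with `x k ≤ x n`. -/
noncomputable def lastRank (x : ℕ → ℝ) (n : ℕ) : Fin (n + 1) :=
  ⟨((Finset.range n).filter fun k => x k ≤ x n).card,
    Nat.lt_succ_of_le ((Finset.card_filter_le _ _).trans (Finset.card_range n).le)⟩

/-- The trajectory of the erased-word process built from a sequence of pairs. -/
noncomputable def pathOf (z : ℕ → A × ℝ) : Path A := fun n =>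
  (inducedOrderStatistics (fun i : Fin (n + 1) => (z i).1) (fun i : Fin (n + 1) => (z i).2),
    lastRank (fun k => (z k).2) n)

variable [MeasurableSpace A]

variable (A) in
/-- The probability measures on `A × ℝ` whose second marginal is uniform on `[0, 1]`. -/
def copulaSpace : Set (ProbabilityMeasure (A × ℝ)) :=
  {ρ | ∀ t ∈ Set.Icc (0 : ℝ) 1,
    (ρ : Measure (A × ℝ)) (Set.univ ×ˢ Set.Icc (0 : ℝ) t) = ENNReal.ofReal t}

/-- The construction is measurable, so that the law below is a genuine image measure. -/
theorem measurable_pathOf : Measurable (pathOf : (ℕ → A × ℝ) → Path A) := by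
  refine measurable_pi_lambda _ fun n => Measurable.prodMk ?_ ?_
  · refine measurable_pi_lambda _ fun i s hs => ?_
    have hS : ∀ σ : Equiv.Perm (Fin (n + 1)), MeasurableSet
        {z : ℕ → A × ℝ | σ = Tuple.sort (fun i : Fin (n + 1) => (z i).2)} := by
      intro σ
      simp only [Tuple.eq_sort_iff, Monotone, Function.comp]
      measurability
    have : (fun z : ℕ → A × ℝ => inducedOrderStatistics (fun i : Fin (n + 1) => (z i).1)
          (fun i : Fin (n + 1) => (z i).2) i) ⁻¹' s =
        ⋃ σ : Equiv.Perm (Fin (n + 1)),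
          {z : ℕ → A × ℝ | σ = Tuple.sort (fun i : Fin (n + 1) => (z i).2)} ∩
            (fun z => (z (σ i)).1) ⁻¹' s := by
      ext z
      simp [inducedOrderStatistics]
    rw [this]
    exact MeasurableSet.iUnion fun σ => (hS σ).inter ((measurable_pi_apply _).fst hs)
  · have hv : Measurable fun z : ℕ → A × ℝ => (lastRank (fun k => (z k).2) n : ℕ) := by
      simp only [lastRank, Finset.card_filter]
      exact Finset.measurable_sum _ fun k _ => Measurable.ite
        (measurableSet_le (measurable_pi_apply k).snd (measurable_pi_apply n).snd)
        measurable_const measurable_const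
    refine measurable_to_countable' fun i => ?_
    have := hv (measurableSet_singleton (i : ℕ))
    simpa [Set.preimage, Fin.ext_iff] using this

/-- `GL(ρ)`: the law of the erased-word process built from an i.i.d. sequence with law `ρ`. -/
noncomputable def glLaw (ρ : ProbabilityMeasure (A × ℝ)) : Measure (Path A) :=
  (Measure.infinitePi fun _ : ℕ => (ρ : Measure (A × ℝ))).map pathOf

end Representation

end ErasedWord

/-! Uniformity and backward independence force the erasers to have a single possible law, the
product of the uniform laws on positions. The relative ranks of an i.i.d. uniform sequence `U` have
the same law (`map_ranks_eq`), so almost sure statements about erasers may be transferred to `U`.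

Suppose the erasers generate the filtration. Each word is then a measurable function of the later
erasers; substituting ranks for erasers yields words built from `U` and consistent with erasing.
Ranks after index `n` do not change when the terms up to index `n` are permuted, so the `n`-th word
is symmetric in those terms. Following the letter attached to `U 0` through all longer words shows
that it is invariant under the finite permutations used here, which fix `0`. Hewitt-Savage, applied
conditionally on `U 0`, makes it a function `f (U 0)`. Transposing `0` and `j` gives the letter `f
(U j)` to the `j`-th term, which is the `GL` construction (`exists_letter_of_symmetric_words`).

Conversely, in the `GL` construction the relative position of a letter converges to its own uniform
variable, by Glivenko-Cantelli, and the evolution of that position depends on the later erasers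
only. Hence each letter is `f` of a function of the later erasers (`ae_limitPos_ranks`). -/

namespace ErasedWord

/-! ### Almost sure factorisation, and the Hewitt-Savage law conditional on the first term -/

section MeasureTheory

/-- A random element of a standard Borel space whose events are almost surely events of `Z` is
almost surely a measurable function of `Z`. -/
theorem exists_measurable_comp_ae_eq {A B Ω : Type*} [MeasurableSpace A] [StandardBorelSpace A]
    [Nonempty A] [MeasurableSpace B] [MeasurableSpace Ω] {μ : Measure Ω} {X : Ω → A} {Z : Ω → B}
    (h : ∀ s, MeasurableSet s → ∃ t, MeasurableSet t ∧ μ (symmDiff (X ⁻¹' s) (Z ⁻¹' t)) = 0) :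
    ∃ G : B → A, Measurable G ∧ X =ᵐ[μ] G ∘ Z := by
  classical
  -- Coding points of `A` by bit sequences reduces the claim to countably many events, whose null
  -- sets can be united; `g` decodes the bits.
  let e := MeasurableSpace.mapNatBool A
  have he : MeasurableEmbedding e := (MeasurableSpace.measurable_mapNatBool A).measurableEmbedding
    (MeasurableSpace.injective_mapNatBool A)
  obtain ⟨g, hg, hge⟩ := he.exists_measurable_extend measurable_id fun _ => inferInstance
  have hs : ∀ n : ℕ, MeasurableSet {a | e a n = true} := fun n =>
    (measurable_pi_apply n).comp he.measurable (measurableSet_singleton true)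
  choose t ht hmt using fun n => h _ (hs n)
  refine ⟨fun b => g fun n => decide (b ∈ t n), hg.comp <| measurable_pi_lambda _ fun n =>
    (measurable_to_bool (by simpa [Set.preimage] using ht n)), ?_⟩
  have hae : ∀ᵐ ω ∂μ, ∀ n, ω ∈ X ⁻¹' {a | e a n = true} ↔ ω ∈ Z ⁻¹' t n :=
    ae_all_iff.2 fun n => (measure_symmDiff_eq_zero_iff.1 (hmt n)).mem_iff
  filter_upwards [hae] with ω hω
  have : (fun n => decide (Z ω ∈ t n)) = e (X ω) := by
    ext n
    have := hω n
    simp only [Set.mem_preimage, Set.mem_ofPred_eq] at this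
    rw [Bool.eq_iff_iff, this]
    simp
  simp only [Function.comp, this]
  exact (congrFun hge (X ω)).symm

/-- The permutation of `ℕ` that exchanges `[0, N)` and `[N, 2 N)`. -/
def blockSwap (N : ℕ) : Equiv.Perm ℕ :=
  Function.Involutive.toPerm
    (fun n => if n < N then n + N else if n < 2 * N then n - N else n) fun n => by
      dsimp only
      split_ifs <;> omega

variable {α : Type*} [MeasurableSpace α] (ν : Measure α) [IsProbabilityMeasure ν]

theorem measurePreserving_comp_perm (σ : Equiv.Perm ℕ) :
    MeasurePreserving (fun (x : ℕ → α) => x ∘ σ) (Measure.infinitePi fun _ => ν)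
      (Measure.infinitePi fun _ => ν) :=
  ⟨measurable_pi_lambda _ fun _ => measurable_pi_apply _,
    Measure.map_infinitePi_infinitePi_of_inj (P := fun _ : ℕ => ν) σ.injective⟩

/-- The two cylinders have the same measure and depend on disjoint sets of coordinates, `s` and its
image under `σ`, so they are independent. -/
theorem infinitePi_cylinder_inter_comp {s : Finset ℕ} {S : Set (s → α)} (hS : MeasurableSet S)
    (σ : Equiv.Perm ℕ) (hσ : ∀ i ∈ s, σ i ∉ s) :
    (Measure.infinitePi fun _ : ℕ => ν).real
        (cylinder s S ∩ (fun (x : ℕ → α) => x ∘ σ) ⁻¹' cylinder s S) =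
      (Measure.infinitePi fun _ : ℕ => ν).real (cylinder s S) ^ 2 := by
  have hind : iIndepFun (fun (i : ℕ) (x : ℕ → α) => x i) (Measure.infinitePi fun _ : ℕ => ν) :=
    iIndepFun_infinitePi (X := fun _ x => x) fun _ => measurable_id
  have hd : Disjoint s (s.map σ.toEmbedding) := by
    rw [Finset.disjoint_right]
    intro a ha
    obtain ⟨i, hi, rfl⟩ := Finset.mem_map.1 ha
    exact hσ i hi
  have h := hind.indepFun_finset s (s.map σ.toEmbedding) hd fun i => measurable_pi_apply i
  let T : (s.map σ.toEmbedding → α) → (s → α) := fun y i =>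
    y ⟨σ i, Finset.mem_map_of_mem _ i.2⟩
  have hT : Measurable T := measurable_pi_lambda _ fun i => measurable_pi_apply _
  have h2 := (h.comp measurable_id hT).measure_inter_preimage_eq_mul S S hS hS
  have h3 := (measurePreserving_comp_perm ν σ).measure_preimage hS.cylinder.nullMeasurableSet
  have h4 : (fun (x : ℕ → α) => x ∘ σ) ⁻¹' cylinder s S =
    (T ∘ fun (x : ℕ → α) (i : s.map σ.toEmbedding) => x i) ⁻¹' S := rfl
  have h5 : cylinder s S = (id ∘ fun (x : ℕ → α) (i : s) => x i) ⁻¹' S := rfl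
  rw [h4] at h3 ⊢
  rw [sq, measureReal_def, measureReal_def, ← ENNReal.toReal_mul]
  congr 1
  calc _ = _ := h2
    _ = _ := by rw [h3, h5]

/-- The **Hewitt-Savage zero-one law**, for sets invariant under the block swaps. -/
theorem infinitePi_real_eq_sq_of_blockSwap {E : Set (ℕ → α)} (hE : MeasurableSet E)
    (h : ∀ N, (fun (x : ℕ → α) => x ∘ blockSwap N) ⁻¹' E =ᵐ[Measure.infinitePi fun _ : ℕ => ν] E) :
    (Measure.infinitePi fun _ : ℕ => ν).real E =
      (Measure.infinitePi fun _ : ℕ => ν).real E ^ 2 := by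
  set P := Measure.infinitePi fun _ : ℕ => ν
  have hdense := Measure.MeasureDense.of_generateFrom_isSetAlgebra_finite P
    (isSetAlgebra_measurableCylinders (α := fun _ : ℕ => α)) generateFrom_measurableCylinders.symm
  -- Approximate `E` by a cylinder `C` within `ε`. By invariance `E` is also within `2 * ε` of the
  -- intersection of `C` with its swapped copy, of measure `P(C) ^ 2`; replacing this by `P(E) ^ 2`
  -- costs another `2 * ε`.
  have key : ∀ ε > 0, |P.real E - P.real E ^ 2| ≤ 4 * ε := by
    intro ε hε
    obtain ⟨C, hC, hCε⟩ := hdense.approx E hE (measure_ne_top _ _) ε hε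
    have hCm := hdense.measurable C hC
    obtain ⟨s, S, hS, rfl⟩ := (mem_measurableCylinders _).1 hC
    obtain ⟨N, hN⟩ := s.exists_nat_subset_range
    set σ := blockSwap N
    have hσ : ∀ i ∈ s, σ i ∉ s := by
      intro i hi hi'
      have h1 := Finset.mem_range.1 (hN hi)
      have h2 := Finset.mem_range.1 (hN hi')
      have : σ i = i + N := if_pos h1
      omega
    set D := (fun (x : ℕ → α) => x ∘ σ) ⁻¹' cylinder s S
    have hEC : P.real (symmDiff E (cylinder s S)) < ε :=
      (ENNReal.ofReal_lt_ofReal_iff hε).1 (by rwa [ofReal_measureReal])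
    have hED : P.real (symmDiff E D) < ε := by
      have h1 : P.real (symmDiff E D) =
          P.real ((fun (x : ℕ → α) => x ∘ σ) ⁻¹' symmDiff E (cylinder s S)) := by
        rw [Set.preimage_symmDiff]
        exact measureReal_congr ((h N).symm.symmDiff .rfl)
      rwa [h1, (measurePreserving_comp_perm ν σ).measureReal_preimage
        (hE.symmDiff hCm).nullMeasurableSet]
    have hD : MeasurableSet D := (measurePreserving_comp_perm ν σ).measurable hCm
    have h1 := abs_measureReal_sub_le_measureReal_symmDiff (μ := P) hE.nullMeasurableSet
      hCm.nullMeasurableSet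
    have h2 := abs_measureReal_sub_le_measureReal_symmDiff (μ := P) hE.nullMeasurableSet
      (hCm.inter hD).nullMeasurableSet
    have h3 : P.real (symmDiff E (cylinder s S ∩ D)) ≤ 2 * ε := by
      have : symmDiff E (cylinder s S ∩ D) ⊆ symmDiff E (cylinder s S) ∪ symmDiff E D := by
        intro x
        simp only [Set.mem_symmDiff, Set.mem_inter_iff, Set.mem_union]
        tauto
      calc _ ≤ _ := measureReal_mono this
        _ ≤ _ := measureReal_union_le _ _
        _ ≤ _ := by linarith
    rw [infinitePi_cylinder_inter_comp ν hS σ hσ] at h2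
    have hp0 : 0 ≤ P.real E := measureReal_nonneg
    have hp1 : P.real E ≤ 1 := measureReal_le_one
    have hc0 : 0 ≤ P.real (cylinder s S) := measureReal_nonneg
    have hc1 : P.real (cylinder s S) ≤ 1 := measureReal_le_one
    rw [abs_le] at *
    constructor <;> nlinarith
  by_contra hne
  have hpos : 0 < |P.real E - P.real E ^ 2| := abs_pos.2 (sub_ne_zero.2 hne)
  have := key (|P.real E - P.real E ^ 2| / 8) (by positivity)
  linarith

/-- The sequence with first term `a` and remaining terms `x`. -/
def seqCons {β : Type*} (p : β × (ℕ → β)) : ℕ → β := fun n => Nat.casesOn n p.1 p.2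

theorem measurable_seqCons : Measurable (seqCons : α × (ℕ → α) → ℕ → α) := by
  refine measurable_pi_lambda _ fun n => ?_
  cases n with
  | zero => exact measurable_fst
  | succ n => exact (measurable_pi_apply n).comp measurable_snd

/-- Splitting off the first term of an i.i.d. sequence: this is what allows Fubini to condition on
that term. -/
theorem measurePreserving_seqCons :
    MeasurePreserving (seqCons : α × (ℕ → α) → ℕ → α)
      (ν.prod (Measure.infinitePi fun _ => ν)) (Measure.infinitePi fun _ => ν) := by
  refine ⟨measurable_seqCons, Measure.eq_infinitePi _ fun s t ht => ?_⟩
  classical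
  rw [Measure.map_apply measurable_seqCons (.pi s.countable_toSet fun _ _ => ht _)]
  let t' : ℕ → Set α := fun n => if n ∈ s then t n else Set.univ
  obtain ⟨N, hN⟩ := s.exists_nat_subset_range
  have ht' : ∀ n, MeasurableSet (t' n) := fun n => by
    dsimp only [t']; split_ifs; exacts [ht n, .univ]
  have h1 : seqCons ⁻¹' Set.pi s t =
      t' 0 ×ˢ Set.pi (Finset.range N) fun n => t' (n + 1) := by
    ext ⟨a, x⟩
    simp only [Set.mem_preimage, Set.mem_pi, Finset.mem_coe, Set.mem_prod, t', Finset.mem_range]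
    constructor
    · refine fun h => ⟨?_, fun n _ => ?_⟩
      · split_ifs with h0
        exacts [h 0 h0, trivial]
      · split_ifs with h0
        exacts [h (n + 1) h0, trivial]
    · rintro ⟨h0, h1⟩ n hn
      cases n with
      | zero => simpa [hn, seqCons] using h0
      | succ n =>
        have := h1 n (by have := Finset.mem_range.1 (hN hn); omega)
        simpa [hn, seqCons] using this
  have h2 : ∏ i ∈ s, ν (t i) = ∏ i ∈ Finset.range (N + 1), ν (t' i) := by
    rw [← Finset.prod_subset (hN.trans (Finset.range_mono N.le_succ))]
    · exact Finset.prod_congr rfl fun i hi => by simp [t', hi]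
    · intro i _ hi
      simp [t', hi]
  rw [h1, Measure.prod_prod, Measure.infinitePi_pi _ fun i _ => ht' _, h2,
    Finset.prod_range_succ', mul_comm]

/-- The permutation that fixes `0` and acts as the block swap on the positive integers. -/
def succBlockSwap (N : ℕ) : Equiv.Perm ℕ :=
  Function.Involutive.toPerm
    (fun n => Nat.casesOn n 0 fun k => blockSwap N k + 1) fun n => by
      cases n with
      | zero => rfl
      | succ k =>
        change blockSwap N (blockSwap N k) + 1 = k + 1
        rw [show blockSwap N (blockSwap N k) = k from
          (blockSwap N).apply_symm_apply k]

theorem succBlockSwap_of_lt {N n : ℕ} (h : 2 * N < n) : succBlockSwap N n = n := by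
  cases n with
  | zero => rfl
  | succ k =>
    change (if k < N then k + N else if k < 2 * N then k - N else k) + 1 = k + 1
    rw [if_neg (by omega), if_neg (by omega)]

theorem seqCons_comp_succBlockSwap {β : Type*} (N : ℕ) (a : β) (x : ℕ → β) :
    seqCons (a, x) ∘ succBlockSwap N = seqCons (a, x ∘ blockSwap N) := by
  ext n
  cases n <;> rfl

/-- A set of sequences that is invariant under the permutations fixing the first term is
determined by the first term. -/
theorem exists_preimage_eval_zero_of_succBlockSwap {E : Set (ℕ → α)} (hE : MeasurableSet E)
    (h : ∀ N, (fun (x : ℕ → α) => x ∘ succBlockSwap N) ⁻¹' E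
      =ᵐ[Measure.infinitePi fun _ : ℕ => ν] E) :
    ∃ t : Set α, MeasurableSet t ∧
      (Measure.infinitePi fun _ : ℕ => ν) (symmDiff E ((fun x => x 0) ⁻¹' t)) = 0 := by
  set P := Measure.infinitePi fun _ : ℕ => ν
  have hc := measurePreserving_seqCons ν
  set E' := seqCons ⁻¹' E
  have hE' : MeasurableSet E' := measurable_seqCons hE
  -- For almost every first term the section of `E` is invariant under block swaps, hence of measure
  -- `0` or `1`; `t` collects the first terms with a full section.
  let t : Set α := {a | P (Prod.mk a ⁻¹' E') = 1}
  have ht : MeasurableSet t := measurable_measure_prodMk_left hE' (measurableSet_singleton 1)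
  refine ⟨t, ht, ?_⟩
  have hinv : ∀ᵐ a ∂ν, ∀ N, (fun (x : ℕ → α) => x ∘ blockSwap N) ⁻¹' (Prod.mk a ⁻¹' E')
      =ᵐ[P] Prod.mk a ⁻¹' E' := by
    refine ae_all_iff.2 fun N => ?_
    have h1 : ∀ᵐ p ∂ν.prod P, (seqCons p ∘ succBlockSwap N ∈ E ↔ seqCons p ∈ E) :=
      hc.quasiMeasurePreserving.ae (h N).mem_iff
    filter_upwards [Measure.ae_ae_of_ae_prod h1] with a ha
    refine Filter.eventuallyEq_set.2 ?_
    filter_upwards [ha] with x hx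
    rwa [seqCons_comp_succBlockSwap] at hx
  have hm : MeasurableSet (symmDiff E ((fun x => x 0) ⁻¹' t)) :=
    hE.symmDiff (measurable_pi_apply 0 ht)
  rw [← hc.measure_preimage hm.nullMeasurableSet, Measure.measure_prod_null
    (measurable_seqCons hm)]
  filter_upwards [hinv] with a ha
  have h01 := infinitePi_real_eq_sq_of_blockSwap ν (measurable_prodMk_left hE') ha
  have h2 : (Prod.mk a ⁻¹' (seqCons ⁻¹' symmDiff E ((fun x => x 0) ⁻¹' t)) : Set (ℕ → α)) =
      symmDiff (Prod.mk a ⁻¹' E') {_x | a ∈ t} := rfl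
  rw [h2]
  by_cases hat : a ∈ t
  · have : ({_x | a ∈ t} : Set (ℕ → α)) = Set.univ := by simp [hat]
    rw [this, ← Set.top_eq_univ, symmDiff_top]
    exact (prob_compl_eq_zero_iff (measurable_prodMk_left hE')).2 hat
  · have : ({_x | a ∈ t} : Set (ℕ → α)) = ∅ := by simp [hat]
    rw [this, ← Set.bot_eq_empty, symmDiff_bot]
    have h3 : P.real (Prod.mk a ⁻¹' E') ≠ 1 := fun h1 => hat <| by
      rw [measureReal_def, ENNReal.toReal_eq_one_iff] at h1
      exact h1
    have h4 : P.real (Prod.mk a ⁻¹' E') * (P.real (Prod.mk a ⁻¹' E') - 1) = 0 := by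
      linear_combination -h01
    rcases mul_eq_zero.1 h4 with h5 | h5
    · exact (measureReal_eq_zero_iff).1 h5
    · exact absurd (sub_eq_zero.1 h5) h3

end MeasureTheory

/-! ### Combinatorics of relative ranks -/

section Ranks

/-- The number of terms among `x 0, …, x n` that are smaller than `x j`. -/
noncomputable def rankAt (x : ℕ → ℝ) (n j : ℕ) : ℕ :=
  ((Finset.range (n + 1)).filter fun k => x k < x j).card

theorem rankAt_lt (x : ℕ → ℝ) {n j : ℕ} (hj : j ≤ n) : rankAt x n j < n + 1 := by
  have : (Finset.range (n + 1)).filter (fun k => x k < x j) ⊂ Finset.range (n + 1) := by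
    rw [Finset.filter_ssubset]
    exact ⟨j, Finset.mem_range.2 (by omega), lt_irrefl _⟩
  simpa [rankAt] using Finset.card_lt_card this

theorem val_lastRank (x : ℕ → ℝ) (n : ℕ) :
    (lastRank x n : ℕ) = ((Finset.range n).filter fun k => x k ≤ x n).card := rfl

theorem rankAt_self {x : ℕ → ℝ} (hx : Function.Injective x) (n : ℕ) :
    rankAt x n n = lastRank x n := by
  rw [rankAt, val_lastRank, Finset.range_add_one, Finset.filter_insert, if_neg (lt_irrefl _)]
  congr 1
  refine Finset.filter_congr fun k hk => ?_
  have : x k ≠ x n := hx.ne (Finset.mem_range.1 hk).ne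
  exact ⟨le_of_lt, fun h => lt_of_le_of_ne h this⟩

/-- A new term raises the rank of `x j` exactly when it lies below `x j`, and this comparison can be
read off from the old rank and the new eraser. So ranks evolve by a rule that involves the erasers
only. -/
theorem rankAt_succ {x : ℕ → ℝ} (hx : Function.Injective x) {n j : ℕ} (hj : j ≤ n) :
    rankAt x (n + 1) j =
      if rankAt x n j < lastRank x (n + 1) then rankAt x n j else rankAt x n j + 1 := by
  have h1 : rankAt x (n + 1) j = rankAt x n j + if x (n + 1) < x j then 1 else 0 := by
    rw [rankAt, Finset.range_add_one, Finset.filter_insert]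
    split_ifs
    · rw [Finset.card_insert_of_notMem (by simp)]; rfl
    · rfl
  have hlt : rankAt x n j < lastRank x (n + 1) ↔ x j < x (n + 1) := by
    rw [val_lastRank]
    constructor
    · intro h
      by_contra! hle
      refine h.not_ge (Finset.card_le_card fun k hk => ?_)
      rw [Finset.mem_filter] at hk ⊢
      refine ⟨hk.1, lt_of_le_of_ne (hk.2.trans hle) (hx.ne ?_)⟩
      rintro rfl
      have := hx (le_antisymm hk.2 hle)
      omega
    · refine fun h => Finset.card_lt_card (Finset.ssubset_iff_of_subset (fun k hk => ?_) |>.2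
        ⟨j, ?_, ?_⟩)
      · rw [Finset.mem_filter] at hk ⊢
        exact ⟨hk.1, (hk.2.trans h).le⟩
      · exact Finset.mem_filter.2 ⟨Finset.mem_range.2 (by omega), h.le⟩
      · simp
  rw [h1]
  have hne : x j ≠ x (n + 1) := hx.ne (by omega)
  rcases lt_or_gt_of_ne hne with h | h
  · rw [if_pos (hlt.2 h), if_neg h.not_gt, add_zero]
  · rw [if_neg (hlt.not.2 h.not_gt), if_pos h]

theorem perm_lt_iff {σ : Equiv.Perm ℕ} {n : ℕ} (hσ : ∀ m, n < m → σ m = m) {m : ℕ} (hm : n ≤ m)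
    (k : ℕ) : σ k < m + 1 ↔ k < m + 1 := by
  constructor
  · intro h
    by_contra! hk
    have := hσ k (by omega)
    omega
  · intro h
    by_contra! hk
    have := σ.injective (hσ (σ k) (by omega))
    omega

theorem card_filter_comp_perm {σ : Equiv.Perm ℕ} {n : ℕ} (hσ : ∀ m, n < m → σ m = m) {m : ℕ}
    (hm : n ≤ m) (p : ℕ → Prop) [DecidablePred p] :
    ((Finset.range (m + 1)).filter fun k => p (σ k)).card =
      ((Finset.range (m + 1)).filter p).card := by
  refine Finset.card_bij (fun k _ => σ k) (fun k hk => ?_) (fun k _ l _ h => σ.injective h)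
    fun k hk => ⟨σ.symm k, ?_, σ.apply_symm_apply k⟩
  · simpa [perm_lt_iff hσ hm] using hk
  · have := perm_lt_iff hσ hm (σ.symm k)
    simp only [Equiv.apply_symm_apply] at this
    simpa [← this] using hk

theorem rankAt_comp_perm (x : ℕ → ℝ) {σ : Equiv.Perm ℕ} {n : ℕ} (hσ : ∀ m, n < m → σ m = m)
    (j : ℕ) : rankAt (x ∘ σ) n j = rankAt x n (σ j) :=
  card_filter_comp_perm hσ le_rfl fun k => x k < x (σ j)

/-- A later rank only counts how many earlier terms lie below, and `σ` merely rearranges those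
terms. This is the source of all the symmetry used below. -/
theorem lastRank_comp_perm (x : ℕ → ℝ) {σ : Equiv.Perm ℕ} {n : ℕ} (hσ : ∀ m, n < m → σ m = m)
    {m : ℕ} (hm : n < m) : lastRank (x ∘ σ) m = lastRank x m := by
  obtain ⟨m, rfl⟩ : ∃ k, m = k + 1 := ⟨m - 1, by omega⟩
  refine Fin.ext ?_
  rw [val_lastRank, val_lastRank]
  simp only [Function.comp, hσ _ hm]
  exact card_filter_comp_perm hσ (by omega) fun k => x k ≤ x (m + 1)

theorem rankAt_sort {x : ℕ → ℝ} (hx : Function.Injective x) {n : ℕ} (i : Fin (n + 1)) :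
    rankAt x n (Tuple.sort (fun i : Fin (n + 1) => x i) i) = i := by
  set σ := Tuple.sort (fun i : Fin (n + 1) => x i)
  have hs : StrictMono fun i => x (σ i) :=
    (Tuple.monotone_sort (fun i : Fin (n + 1) => x i)).strictMono_of_injective
      (hx.comp (Fin.val_injective.comp σ.injective))
  rw [rankAt, ← Fin.card_Iio i]
  refine (Finset.card_bij (fun k _ => (σ k : ℕ)) (fun k hk => ?_)
    (fun k _ l _ h => σ.injective (Fin.ext h)) fun k hk => ?_).symm
  · rw [Finset.mem_filter]
    exact ⟨Finset.mem_range.2 (σ k).2, hs (Finset.mem_Iio.1 hk)⟩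
  · rw [Finset.mem_filter, Finset.mem_range] at hk
    refine ⟨σ.symm ⟨k, hk.1⟩, Finset.mem_Iio.2 (hs.lt_iff_lt.1 ?_), by simp⟩
    simpa using hk.2

theorem existsUnique_rankAt_eq {x : ℕ → ℝ} (hx : Function.Injective x) {n i : ℕ} (hi : i < n + 1) :
    ∃! j, j ∈ Finset.range (n + 1) ∧ rankAt x n j = i := by
  set σ := Tuple.sort (fun i : Fin (n + 1) => x i)
  refine ⟨σ ⟨i, hi⟩, ⟨Finset.mem_range.2 (σ _).2, rankAt_sort hx _⟩, ?_⟩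
  rintro j ⟨hj, rfl⟩
  have h := rankAt_sort hx (σ.symm ⟨j, Finset.mem_range.1 hj⟩)
  simp only [σ, Equiv.apply_symm_apply] at h
  have : (⟨rankAt x n j, hi⟩ : Fin (n + 1)) = σ.symm ⟨j, Finset.mem_range.1 hj⟩ := Fin.ext h
  rw [this, Equiv.apply_symm_apply]

/-- The index shift of `Fin.succAbove` is the update rule of `rankAt_succ`, so a letter stays
attached to the same term `x j` as the word grows. -/
theorem word_rankAt_succ {A : Type*} {x : ℕ → ℝ} (hx : Function.Injective x) {n : ℕ} {v : Fin (n + 1) → A}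
    {v' : Fin (n + 1 + 1) → A} (h : v = erase v' (lastRank x (n + 1))) {j : ℕ} (hj : j ≤ n) :
    v ⟨rankAt x n j, rankAt_lt x hj⟩ = v' ⟨rankAt x (n + 1) j, rankAt_lt x (by omega)⟩ := by
  subst h
  refine congrArg v' (Fin.ext ?_)
  change _ = rankAt x (n + 1) j
  by_cases hlt : rankAt x n j < lastRank x (n + 1)
  · rw [rankAt_succ hx hj, if_pos hlt, Fin.succAbove_of_castSucc_lt _ _ hlt]
    rfl
  · rw [rankAt_succ hx hj, if_neg hlt, Fin.succAbove_of_le_castSucc _ _ (not_lt.1 hlt)]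
    rfl

theorem word_rankAt_zero {A : Type*} {x : ℕ → ℝ} (hx : Function.Injective x)
    {v : (n : ℕ) → Fin (n + 1) → A}
    (h : ∀ n, v n = erase (v (n + 1)) (lastRank x (n + 1))) (n : ℕ) :
    v n ⟨rankAt x n 0, rankAt_lt x n.zero_le⟩ = v 0 0 := by
  induction n with
  | zero => exact congrArg (v 0) (Subsingleton.elim (α := Fin 1) _ _)
  | succ n ih => rw [← ih, word_rankAt_succ hx (h n) n.zero_le]

end Ranks

/-! ### Erasers and ranks of uniform variables have the same law -/

section RankLaw

/-- Presents the `σ`-field as that of a single random sequence, so that its events are preimages and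
its random variables factor. -/
theorem eraserFuture_eq_comap {Ω : Type*} (η : (n : ℕ) → Ω → Fin (n + 1)) (n : ℕ) :
    eraserFuture η n =
      MeasurableSpace.comap (fun ω (k : ℕ) => η (n + 1 + k) ω) MeasurableSpace.pi := by
  rw [MeasurableSpace.pi, MeasurableSpace.comap_iSup]
  simp only [MeasurableSpace.comap_comp]
  refine le_antisymm (iSup₂_le fun k hk => ?_) (iSup_le fun k => ?_)
  · obtain ⟨d, rfl⟩ := Nat.exists_eq_add_of_le hk
    exact le_iSup (fun d : ℕ => MeasurableSpace.comap (η (n + 1 + d)) inferInstance) d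
  · exact le_iSup₂_of_le (f := fun k (_ : n + 1 ≤ k) =>
      MeasurableSpace.comap (η k) inferInstance) (n + 1 + k) (by omega) le_rfl

theorem eraserFuture_le_backwardFiltration {A Ω : Type*} [MeasurableSpace A]
    (W : (n : ℕ) → Ω → (Fin (n + 1) → A)) (η : (n : ℕ) → Ω → Fin (n + 1)) (n : ℕ) :
    eraserFuture η n ≤ backwardFiltration W η n := by
  refine iSup₂_le fun k hk => ?_
  obtain ⟨d, rfl⟩ := Nat.exists_eq_add_of_le' hk
  exact le_iSup₂_of_le (f := fun k (_ : n ≤ k) => MeasurableSpace.comap (W k) inferInstance ⊔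
    MeasurableSpace.comap (η (k + 1)) inferInstance) (d + n) (by omega) le_sup_right

/-- The uniform distribution on `Fin (n + 1)`. -/
noncomputable def uniformFin (n : ℕ) : Measure (Fin (n + 1)) :=
  ((n : ℝ≥0∞) + 1)⁻¹ • Measure.count

instance (n : ℕ) : IsProbabilityMeasure (uniformFin n) := by
  refine ⟨?_⟩
  rw [uniformFin, Measure.smul_apply, Measure.count_univ]
  simp only [ENat.card_eq_coe_fintype_card, Fintype.card_fin, smul_eq_mul]
  push_cast
  exact ENNReal.inv_mul_cancel (by simp) (by finiteness)

/-- Erasers that are uniform and independent of the later ones form an independent sequence. -/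
theorem map_eq_infinitePi_uniformFin {Ω : Type*} [MeasurableSpace Ω] {μ : Measure Ω}
    [IsProbabilityMeasure μ] {η : (n : ℕ) → Ω → Fin (n + 1)} (hη : ∀ n, Measurable (η n))
    (h : ∀ n i t, MeasurableSet[eraserFuture η n] t →
      μ (η n ⁻¹' {i} ∩ t) = ((n : ℝ≥0∞) + 1)⁻¹ * μ t) :
    μ.map (fun ω n => η n ω) = Measure.infinitePi uniformFin := by
  classical
  have hset : ∀ n s t, MeasurableSet[eraserFuture η n] t →
      μ (η n ⁻¹' s ∩ t) = uniformFin n s * μ t := by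
    intro n s t ht
    have ht' : MeasurableSet t := (iSup₂_le fun k _ => (hη k).comap_le :
      eraserFuture η n ≤ _) t ht
    have : (μ.restrict t).map (η n) = μ t • uniformFin n := by
      refine Measure.ext_of_singleton fun i => ?_
      rw [Measure.map_apply (hη n) (measurableSet_singleton i),
        Measure.restrict_apply (hη n (measurableSet_singleton i)), h n i t ht]
      simp [uniformFin, mul_comm]
    have h2 := congrArg (fun κ => κ s) this
    simp only [Measure.map_apply (hη n) (MeasurableSet.of_discrete : MeasurableSet s),
      Measure.restrict_apply (hη n (MeasurableSet.of_discrete : MeasurableSet s)),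
      Measure.smul_apply, smul_eq_mul] at h2
    rw [h2, mul_comm]
  -- The starting index `a` varies in the induction on `d`: each step peels off the earliest eraser,
  -- which is independent of the later ones.
  have hbox : ∀ (t : (n : ℕ) → Set (Fin (n + 1))) (d a : ℕ),
      μ {ω | ∀ k < d, η (a + k) ω ∈ t (a + k)} =
        ∏ k ∈ Finset.range d, uniformFin (a + k) (t (a + k)) := by
    intro t d
    induction d with
    | zero => intro a; simp
    | succ d ih =>
      intro a
      have h1 : {ω | ∀ k < d + 1, η (a + k) ω ∈ t (a + k)} =
          η a ⁻¹' t a ∩ {ω | ∀ k < d, η (a + 1 + k) ω ∈ t (a + 1 + k)} := by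
        ext ω
        have hcast : ∀ m m', m = m' → η m ω ∈ t m → η m' ω ∈ t m' := by
          rintro m _ rfl h
          exact h
        simp only [Set.mem_ofPred_eq, Set.mem_inter_iff, Set.mem_preimage]
        constructor
        · refine fun h => ⟨h 0 (by omega), fun k hk => ?_⟩
          exact hcast _ _ (by omega) (h (k + 1) (by omega))
        · rintro ⟨h0, h1⟩ k hk
          cases k with
          | zero => exact h0
          | succ k => exact hcast _ _ (by omega) (h1 k (by omega))
      have h2 : MeasurableSet[eraserFuture η a]
          {ω | ∀ k < d, η (a + 1 + k) ω ∈ t (a + 1 + k)} := by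
        rw [eraserFuture_eq_comap]
        refine ⟨{e | ∀ k < d, e k ∈ t (a + 1 + k)}, ?_, rfl⟩
        have : {e : (k : ℕ) → Fin (a + 1 + k + 1) | ∀ k < d, e k ∈ t (a + 1 + k)} =
            Set.pi (Finset.range d) fun k => t (a + 1 + k) := by ext; simp
        rw [this]
        exact .pi (Finset.countable_toSet _) fun _ _ => .of_discrete
      rw [h1, hset a _ _ h2, ih (a + 1), Finset.prod_range_succ', mul_comm, add_zero]
      have hcast : ∀ m m', m = m' → uniformFin m (t m) = uniformFin m' (t m') := by
        rintro m _ rfl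
        rfl
      congr 1
      exact Finset.prod_congr rfl fun k _ => hcast _ _ (by omega)
  refine Measure.eq_infinitePi _ fun s t ht => ?_
  have hm : Measurable fun ω n => η n ω := measurable_pi_lambda _ hη
  rw [Measure.map_apply hm (.pi s.countable_toSet fun _ _ => ht _)]
  obtain ⟨N, hN⟩ := s.exists_nat_subset_range
  -- Padding with full factors turns a box over `s` into one over an initial segment.
  let t' : (n : ℕ) → Set (Fin (n + 1)) := fun n => if n ∈ s then t n else Set.univ
  have h2 : (fun ω n => η n ω) ⁻¹' Set.pi s t = {ω | ∀ k < N, η (0 + k) ω ∈ t' (0 + k)} := by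
    ext ω
    simp only [Set.mem_preimage, Set.mem_pi, Finset.mem_coe, Set.mem_ofPred_eq]
    constructor
    · intro h k _
      rw [zero_add]
      dsimp only [t']
      split_ifs with hk
      exacts [h k hk, trivial]
    · intro h k hk
      have := h k (Finset.mem_range.1 (hN hk))
      rw [zero_add] at this
      simpa [t', hk] using this
  have h3 := hbox t' N 0
  rw [h2, h3]
  have h4 : ∀ k, uniformFin (0 + k) (t' (0 + k)) = uniformFin k (t' k) := fun k => by
    rw [zero_add]
  simp only [h4]
  rw [← Finset.prod_subset hN fun i _ hi => by simp [t', hi]]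
  exact Finset.prod_congr rfl fun i hi => by simp [t', hi]

theorem IsGEWP.map_eraser_eq {A Ω : Type*} [MeasurableSpace A] [MeasurableSpace Ω]
    {W : (n : ℕ) → Ω → (Fin (n + 1) → A)} {η : (n : ℕ) → Ω → Fin (n + 1)} {μ : Measure Ω}
    [IsProbabilityMeasure μ] (h : IsGEWP W η μ) :
    μ.map (fun ω n => η n ω) = Measure.infinitePi uniformFin :=
  map_eq_infinitePi_uniformFin h.measurable_eraser fun n i t ht => by
    rw [(Indep_iff _ _ μ).1 (h.indep n) _ _ ⟨{i}, measurableSet_singleton i, rfl⟩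
      (eraserFuture_le_backwardFiltration W η n t ht), ← h.uniform n i]
    rfl

/-- The law of a sequence of independent uniform random variables on the unit interval. -/
noncomputable abbrev uniformSeq : Measure (ℕ → unitInterval) :=
  Measure.infinitePi fun _ => volume

/-- The relative ranks of a sequence in the unit interval. -/
noncomputable def ranks (n : ℕ) (u : ℕ → unitInterval) : Fin (n + 1) :=
  lastRank (fun k => (u k : ℝ)) n

theorem measurable_ranks (n : ℕ) : Measurable (ranks n) := by
  have h : Measurable fun (u : ℕ → unitInterval) (k : ℕ) => ((), (u k : ℝ)) :=
    measurable_pi_lambda _ fun k =>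
      measurable_const.prodMk (measurable_subtype_coe.comp (measurable_pi_apply k))
  exact ((measurable_pi_apply n).comp (measurable_pathOf.comp h)).snd

theorem ranks_comp_perm (u : ℕ → unitInterval) {σ : Equiv.Perm ℕ} {n : ℕ}
    (hσ : ∀ m, n < m → σ m = m) {m : ℕ} (hm : n < m) : ranks m (u ∘ σ) = ranks m u :=
  lastRank_comp_perm (fun k => (u k : ℝ)) hσ hm

theorem ae_injective_uniformSeq :
    ∀ᵐ u ∂uniformSeq, Function.Injective fun k => (u k : ℝ) := by
  have h : ∀ j k : ℕ, j ≠ k → ∀ᵐ u ∂uniformSeq, u j ≠ u k := by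
    intro j k hjk
    have hm : Measurable fun u : ℕ → unitInterval => (u j, u k) :=
      (measurable_pi_apply j).prodMk (measurable_pi_apply k)
    have h1 : ∀ᵐ p ∂(volume : Measure unitInterval).prod (volume : Measure unitInterval),
        p.1 ≠ p.2 := by
      have hd : MeasurableSet {p : unitInterval × unitInterval | p.1 ≠ p.2} :=
        (measurableSet_eq_fun measurable_fst measurable_snd).compl
      refine (Measure.ae_prod_iff_ae_ae hd).2 (Filter.Eventually.of_forall fun a => ?_)
      filter_upwards [Measure.ae_ne volume a] with b hb
      exact hb.symm
    rw [← Measure.infinitePi_map_eval_prod (P := fun _ : ℕ => (volume : Measure unitInterval))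
      hjk] at h1
    exact ae_of_ae_map hm.aemeasurable h1
  have h' : ∀ᵐ u ∂uniformSeq, ∀ j k : ℕ, j ≠ k → u j ≠ u k := by
    simp only [ae_all_iff]
    exact h
  filter_upwards [h'] with u hu j k hjk
  by_contra hne
  exact hu j k hne (Subtype.ext hjk)

theorem measurable_rankAt (n j : ℕ) :
    Measurable fun u : ℕ → unitInterval => rankAt (fun k => (u k : ℝ)) n j := by
  have hc : ∀ k, Measurable fun u : ℕ → unitInterval => (u k : ℝ) := fun k =>
    measurable_subtype_coe.comp (measurable_pi_apply k)
  simp only [rankAt, Finset.card_filter]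
  exact Finset.measurable_sum _ fun k _ => Measurable.ite (measurableSet_lt (hc k) (hc j))
    measurable_const measurable_const

/-- The event `t` is invariant under permutations of the terms up to index `n`, so by
exchangeability each of these `n + 1` terms is equally likely to have rank `i` jointly with `t`.
Almost surely exactly one of them does, so these probabilities sum to that of `t`. -/
theorem uniformSeq_ranks_inter (n : ℕ) (i : Fin (n + 1)) {t : Set (ℕ → unitInterval)}
    (ht : MeasurableSet[eraserFuture ranks n] t) :
    uniformSeq (ranks n ⁻¹' {i} ∩ t) = ((n : ℝ≥0∞) + 1)⁻¹ * uniformSeq t := by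
  have ht' : MeasurableSet t := (iSup₂_le fun k _ => (measurable_ranks k).comap_le :
    eraserFuture ranks n ≤ _) t ht
  have hinv : ∀ σ : Equiv.Perm ℕ, (∀ m, n < m → σ m = m) → ∀ u, u ∘ σ ∈ t ↔ u ∈ t := by
    intro σ hσ u
    rw [eraserFuture_eq_comap] at ht
    obtain ⟨T, -, rfl⟩ := ht
    have : (fun k => ranks (n + 1 + k) (u ∘ σ)) = fun k => ranks (n + 1 + k) u :=
      funext fun k => ranks_comp_perm u hσ (by omega)
    simp only [Set.mem_preimage, this]
  let E : ℕ → Set (ℕ → unitInterval) := fun j =>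
    {u | rankAt (fun k => (u k : ℝ)) n j = i} ∩ t
  have hE : ∀ j, MeasurableSet (E j) := fun j =>
    (measurable_rankAt n j (measurableSet_singleton (i : ℕ))).inter ht'
  have h1 : ∀ j ∈ Finset.range (n + 1), uniformSeq (E j) = uniformSeq (E n) := by
    intro j hj
    have hσ : ∀ m, n < m → Equiv.swap j n m = m := fun m hm =>
      Equiv.swap_apply_of_ne_of_ne (by have := Finset.mem_range.1 hj; omega) (by omega)
    rw [← (measurePreserving_comp_perm volume (Equiv.swap j n)).measure_preimage
      (hE n).nullMeasurableSet]
    congr 1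
    ext u
    have := rankAt_comp_perm (fun k => (u k : ℝ)) hσ n
    rw [Equiv.swap_apply_right] at this
    simp only [E, Set.mem_inter_iff, Set.mem_preimage, Set.mem_ofPred_eq, hinv _ hσ, ← this]
    rfl
  have h2 : uniformSeq (E n) = uniformSeq (ranks n ⁻¹' {i} ∩ t) := by
    refine measure_congr (Filter.eventuallyEq_set.2 ?_)
    filter_upwards [ae_injective_uniformSeq] with u hu
    simp only [E, Set.mem_inter_iff, Set.mem_preimage, Set.mem_ofPred_eq, rankAt_self hu,
      Set.mem_singleton_iff, Fin.ext_iff]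
    rfl
  have h3 : uniformSeq t = ∑ j ∈ Finset.range (n + 1), uniformSeq (E j) := by
    have : ∀ᵐ u ∂uniformSeq, t.indicator (fun _ => (1 : ℝ≥0∞)) u =
        ∑ j ∈ Finset.range (n + 1), (E j).indicator (fun _ => 1) u := by
      filter_upwards [ae_injective_uniformSeq] with u hu
      by_cases hut : u ∈ t
      · obtain ⟨j, ⟨hj, hji⟩, huniq⟩ := existsUnique_rankAt_eq hu i.2
        rw [Finset.sum_eq_single j, Set.indicator_of_mem hut, Set.indicator_of_mem (show u ∈ E j from ⟨hji, hut⟩)]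
        · intro k hk hkj
          exact Set.indicator_of_notMem (fun h => hkj (huniq k ⟨hk, h.1⟩)) _
        · exact fun h => absurd hj h
      · rw [Set.indicator_of_notMem hut, Finset.sum_eq_zero]
        exact fun k _ => Set.indicator_of_notMem (fun h => hut h.2) _
    calc uniformSeq t = ∫⁻ u, t.indicator (fun _ => 1) u ∂uniformSeq :=
          (lintegral_indicator_one ht').symm
      _ = ∫⁻ u, ∑ j ∈ Finset.range (n + 1), (E j).indicator (fun _ => 1) u ∂uniformSeq :=
          lintegral_congr_ae this
      _ = ∑ j ∈ Finset.range (n + 1), ∫⁻ u, (E j).indicator (fun _ => 1) u ∂uniformSeq :=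
          lintegral_finsetSum _ fun j _ => measurable_const.indicator (hE j)
      _ = _ := Finset.sum_congr rfl fun j _ => lintegral_indicator_one (hE j)
  rw [h3, Finset.sum_congr rfl h1, h2, Finset.sum_const, Finset.card_range, nsmul_eq_mul,
    ← mul_assoc, Nat.cast_add_one, ENNReal.inv_mul_cancel (by simp) (by finiteness), one_mul]

theorem map_ranks_eq :
    uniformSeq.map (fun u n => ranks n u) = Measure.infinitePi uniformFin :=
  map_eq_infinitePi_uniformFin measurable_ranks fun n i _ ht => uniformSeq_ranks_inter n i ht

end RankLaw

/-! ### From filtrations generated by the erasers to the representation -/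

section Forward

variable {A : Type*} [MeasurableSpace A]

theorem measurable_graph_unitInterval {f : unitInterval → A} (hf : Measurable f) :
    Measurable fun u : unitInterval => (f u, (u : ℝ)) :=
  hf.prodMk measurable_subtype_coe

theorem measurable_graph_seq {f : unitInterval → A} (hf : Measurable f) :
    Measurable fun (u : ℕ → unitInterval) (k : ℕ) => (f (u k), (u k : ℝ)) :=
  measurable_pi_lambda _ fun k => (measurable_graph_unitInterval hf).comp (measurable_pi_apply k)

theorem glLaw_eq_map_uniformSeq {ρ : ProbabilityMeasure (A × ℝ)} {f : unitInterval → A}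
    (hf : Measurable f)
    (hρ : (ρ : Measure (A × ℝ)) = (volume : Measure unitInterval).map fun u => (f u, (u : ℝ))) :
    glLaw ρ = uniformSeq.map fun u => pathOf fun k => (f (u k), (u k : ℝ)) := by
  have h := Measure.infinitePi_map_pi (fun _ : ℕ => (volume : Measure unitInterval))
    (f := fun _ u => (f u, (u : ℝ))) fun _ => measurable_graph_unitInterval hf
  rw [glLaw, hρ, ← h, Measure.map_map measurable_pathOf (measurable_graph_seq hf)]
  rfl

theorem exists_copula_of_measurable {f : unitInterval → A} (hf : Measurable f) :
    ∃ ρ ∈ copulaSpace A,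
      (ρ : Measure (A × ℝ)) = (volume : Measure unitInterval).map fun u => (f u, (u : ℝ)) := by
  have hm := measurable_graph_unitInterval hf
  refine ⟨⟨_, Measure.isProbabilityMeasure_map hm.aemeasurable⟩, fun t ht => ?_, rfl⟩
  change (volume : Measure unitInterval).map _ _ = _
  rw [Measure.map_apply hm (MeasurableSet.univ.prod measurableSet_Icc)]
  have : (fun u : unitInterval => (f u, (u : ℝ))) ⁻¹' Set.univ ×ˢ Set.Icc 0 t =
      Set.Iic ⟨t, ht⟩ := by
    ext u
    simp only [Set.mem_preimage, Set.mem_prod, Set.mem_univ, true_and, Set.mem_Icc, u.2.1,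
      Set.mem_Iic]
    rfl
  rw [this, unitInterval.volume_Iic]

theorem measurable_erase (n : ℕ) :
    Measurable fun p : (Fin (n + 1) → A) × Fin (n + 1) => erase p.1 p.2 :=
  measurable_from_prod_countable_left fun i =>
    measurable_pi_lambda _ fun j => measurable_pi_apply (i.succAbove j)

variable [StandardBorelSpace A]

/-- If the filtration is generated by the erasers, the words are functions of the later erasers. -/
theorem IsGeneratedByEraser.exists_word_eq [Nonempty A] {Ω : Type*} [MeasurableSpace Ω]
    {W : (n : ℕ) → Ω → (Fin (n + 1) → A)} {η : (n : ℕ) → Ω → Fin (n + 1)} {μ : Measure Ω}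
    (h : IsGeneratedByEraser W η μ) (n : ℕ) :
    ∃ G : ((k : ℕ) → Fin (n + 1 + k + 1)) → (Fin (n + 1) → A), Measurable G ∧
      ∀ᵐ ω ∂μ, W n ω = G fun k => η (n + 1 + k) ω := by
  refine exists_measurable_comp_ae_eq fun s hs => ?_
  have hle : MeasurableSpace.comap (W n) inferInstance ≤ backwardFiltration W η n :=
    le_iSup₂_of_le (f := fun k (_ : n ≤ k) => MeasurableSpace.comap (W k) inferInstance ⊔
      MeasurableSpace.comap (η (k + 1)) inferInstance) n le_rfl le_sup_left
  obtain ⟨t, ht, hst⟩ := (h n).1 (W n ⁻¹' s) (hle _ ⟨s, hs, rfl⟩)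
  rw [eraserFuture_eq_comap] at ht
  obtain ⟨T, hT, rfl⟩ := ht
  exact ⟨T, hT, hst⟩

/-- If words that depend symmetrically on initial segments of a uniform sequence are consistent
with erasing, then their letters are functions of the corresponding terms of the sequence. -/
theorem exists_letter_of_symmetric_words [Nonempty A]
    {w : (n : ℕ) → (ℕ → unitInterval) → (Fin (n + 1) → A)} (hw : ∀ n, Measurable (w n))
    (hsymm : ∀ n u, ∀ σ : Equiv.Perm ℕ, (∀ m, n < m → σ m = m) → w n (u ∘ σ) = w n u)
    (herase : ∀ n, ∀ᵐ u ∂uniformSeq, w n u = erase (w (n + 1) u) (ranks (n + 1) u)) :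
    ∃ f : unitInterval → A, Measurable f ∧
      ∀ᵐ u ∂uniformSeq, ∀ n, w n u =
        inducedOrderStatistics (fun i : Fin (n + 1) => f (u i))
          (fun i : Fin (n + 1) => (u i : ℝ)) := by
  have herase' := ae_all_iff.2 herase
  -- The word at index `0` has one letter, the one attached to the term `u 0`.
  let Y : (ℕ → unitInterval) → A := fun u => w 0 u 0
  have hY : Measurable Y := (measurable_pi_apply 0).comp (hw 0)
  -- Apply letter tracking to the permuted sequence, then use the symmetry of `w n` to return to
  -- `u`: the letter read is the one attached to `u (σ 0)`.
  have hYσ : ∀ σ : Equiv.Perm ℕ, ∀ n, (∀ m, n < m → σ m = m) → ∀ hσ : σ 0 ≤ n,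
      ∀ᵐ u ∂uniformSeq, Y (u ∘ σ) =
        w n u ⟨rankAt (fun k => (u k : ℝ)) n (σ 0), rankAt_lt _ hσ⟩ := by
    intro σ n hn hσ
    have hq := (measurePreserving_comp_perm (volume : Measure unitInterval) σ).quasiMeasurePreserving
    filter_upwards [hq.ae herase', hq.ae ae_injective_uniformSeq] with u hu hinj
    have h1 := word_rankAt_zero hinj hu n
    rw [hsymm n u σ hn] at h1
    exact h1.symm.trans (congrArg (w n u) (Fin.ext
      (rankAt_comp_perm (fun k => (u k : ℝ)) hn 0)))
  have hinv : ∀ N, ∀ᵐ u ∂uniformSeq, Y (u ∘ succBlockSwap N) = Y u := by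
    intro N
    filter_upwards [hYσ (succBlockSwap N) (2 * N) (fun m hm => succBlockSwap_of_lt hm)
      (Nat.zero_le _), herase', ae_injective_uniformSeq] with u hu hu' hinj
    exact hu.trans (word_rankAt_zero hinj hu' _)
  obtain ⟨f, hf, hfY⟩ := exists_measurable_comp_ae_eq (μ := uniformSeq) (X := Y)
    (Z := fun u => u 0) fun s hs =>
      exists_preimage_eval_zero_of_succBlockSwap volume (hY hs) fun N =>
        Filter.eventuallyEq_set.2 <| by
          filter_upwards [hinv N] with u hu
          simp only [Set.mem_preimage, hu]
  refine ⟨f, hf, ?_⟩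
  have hletter : ∀ᵐ u ∂uniformSeq, ∀ n j, ∀ hj : j ≤ n,
      w n u ⟨rankAt (fun k => (u k : ℝ)) n j, rankAt_lt _ hj⟩ = f (u j) := by
    simp only [ae_all_iff]
    intro n j hj
    have hq := (measurePreserving_comp_perm (volume : Measure unitInterval)
      (Equiv.swap 0 j)).quasiMeasurePreserving
    have h0 : Equiv.swap 0 j 0 = j := Equiv.swap_apply_left 0 j
    filter_upwards [hYσ (Equiv.swap 0 j) n
      (fun m hm => Equiv.swap_apply_of_ne_of_ne (by omega) (by omega)) (h0.trans_le hj),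
      hq.ae hfY] with u hu hfu
    simp only [Function.comp, h0] at hu hfu
    exact hu.symm.trans hfu
  filter_upwards [hletter, ae_injective_uniformSeq] with u hu hinj n
  ext i
  have h := hu n (Tuple.sort (fun i : Fin (n + 1) => (u i : ℝ)) i) (by omega)
  rw [inducedOrderStatistics, ← h]
  exact congrArg (w n u) (Fin.ext (rankAt_sort hinj i).symm)

/-- Since the words are almost surely functions `V n` of the erasers, the joint law is an image of
the eraser law. Replacing erasers by ranks changes neither this law nor the consistency with
erasing. -/
theorem IsGEWP.exists_glLaw_eq {Ω : Type*} [MeasurableSpace Ω]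
    {W : (n : ℕ) → Ω → (Fin (n + 1) → A)} {η : (n : ℕ) → Ω → Fin (n + 1)} {μ : Measure Ω}
    [IsProbabilityMeasure μ] (h : IsGEWP W η μ) (hg : IsGeneratedByEraser W η μ) :
    ∃ ρ ∈ copulaSpace A,
      (∃ f : unitInterval → A, Measurable f ∧
        (ρ : Measure (A × ℝ)) =
          (volume : Measure unitInterval).map (fun u => (f u, (u : ℝ)))) ∧
      law W η μ = glLaw ρ := by
  have : Nonempty A := ⟨W 0 (nonempty_of_isProbabilityMeasure μ).some 0⟩
  choose G hG hWG using hg.exists_word_eq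
  let V : (n : ℕ) → ((n : ℕ) → Fin (n + 1)) → (Fin (n + 1) → A) := fun n e =>
    G n fun k => e (n + 1 + k)
  have hV : ∀ n, Measurable (V n) := fun n =>
    (hG n).comp (measurable_pi_lambda _ fun k => measurable_pi_apply (n + 1 + k))
  have hη : Measurable fun ω n => η n ω := measurable_pi_lambda _ h.measurable_eraser
  have hr : Measurable fun u n => ranks n u := measurable_pi_lambda _ measurable_ranks
  have hmap : μ.map (fun ω n => η n ω) = uniformSeq.map fun u n => ranks n u :=
    h.map_eraser_eq.trans map_ranks_eq.symm
  have herase : ∀ n, ∀ᵐ u ∂uniformSeq, V n (fun m => ranks m u) =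
      erase (V (n + 1) fun m => ranks m u) (ranks (n + 1) u) := by
    intro n
    have h1 : ∀ᵐ ω ∂μ, V n (fun m => η m ω) = erase (V (n + 1) fun m => η m ω) (η (n + 1) ω) := by
      filter_upwards [hWG n, hWG (n + 1), h.erase_eq n] with ω h1 h2 h3
      rw [h1, h2] at h3
      exact h3
    have hset : MeasurableSet {e : (n : ℕ) → Fin (n + 1) |
        V n e = erase (V (n + 1) e) (e (n + 1))} := by
      let _ := upgradeStandardBorel (Fin (n + 1) → A)
      exact measurableSet_eq_fun (hV n)
        ((measurable_erase (n + 1)).comp ((hV (n + 1)).prodMk (measurable_pi_apply (n + 1))))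
    have h2 := (ae_map_iff hη.aemeasurable hset).2 h1
    rw [hmap] at h2
    exact ae_of_ae_map hr.aemeasurable h2
  obtain ⟨f, hf, hfw⟩ := exists_letter_of_symmetric_words (w := fun n u => V n fun m => ranks m u)
    (fun n => (hV n).comp hr)
    (fun n u σ hσ => congrArg (G n) (funext fun k => ranks_comp_perm u hσ (by omega))) herase
  obtain ⟨ρ, hρ, hρf⟩ := exists_copula_of_measurable hf
  refine ⟨ρ, hρ, ⟨f, hf, hρf⟩, ?_⟩
  have hΦ : Measurable fun (e : (n : ℕ) → Fin (n + 1)) (n : ℕ) => (V n e, e n) :=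
    measurable_pi_lambda _ fun n => (hV n).prodMk (measurable_pi_apply n)
  rw [glLaw_eq_map_uniformSeq hf hρf, law]
  calc μ.map (fun ω n => (W n ω, η n ω))
      = μ.map (fun ω n => (V n (fun m => η m ω), η n ω)) := by
        refine Measure.map_congr ?_
        filter_upwards [ae_all_iff.2 hWG] with ω hω
        exact funext fun n => Prod.ext (hω n) rfl
    _ = (μ.map fun ω n => η n ω).map (fun e n => (V n e, e n)) :=
        (Measure.map_map hΦ hη).symm
    _ = uniformSeq.map (fun u n => (V n (fun m => ranks m u), ranks n u)) := by
        rw [hmap, Measure.map_map hΦ hr]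
        rfl
    _ = _ := by
        refine Measure.map_congr ?_
        filter_upwards [hfw] with u hu
        exact funext fun n => Prod.ext (hu n) rfl

end Forward

/-! ### Recovering the letters of the representation from the later erasers -/

section Backward

/-- The position at time `n + k` of the letter that has position `i` at time `n`, when the
erasers are `e`. -/
def trackedPos (e : (n : ℕ) → Fin (n + 1)) (n i : ℕ) : ℕ → ℕ
  | 0 => i
  | k + 1 =>
    if trackedPos e n i k < e (n + k + 1) then trackedPos e n i k else trackedPos e n i k + 1

/-- The limiting relative position of the letter that has position `i` at time `n`. -/
noncomputable def limitPos (e : (n : ℕ) → Fin (n + 1)) (n i : ℕ) : ℝ :=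
  Filter.limsup (fun k : ℕ => (trackedPos e n i k : ℝ) / ((n + k : ℕ) + 1 : ℝ)) Filter.atTop

theorem measurable_trackedPos {Ω : Type*} (η : (n : ℕ) → Ω → Fin (n + 1)) (n i k : ℕ) :
    Measurable[eraserFuture η n] fun ω => trackedPos (fun m => η m ω) n i k := by
  let _ : MeasurableSpace Ω := eraserFuture η n
  induction k with
  | zero => exact measurable_const
  | succ k ih =>
    have hη : Measurable (η (n + k + 1)) := Measurable.mono (comap_measurable _)
      (le_iSup₂_of_le (f := fun k (_ : n + 1 ≤ k) => MeasurableSpace.comap (η k) inferInstance)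
        (n + k + 1) (by omega) le_rfl) le_rfl
    have hη' : Measurable fun ω => (η (n + k + 1) ω : ℕ) := measurable_from_top.comp hη
    exact Measurable.ite (measurableSet_lt ih hη') ih (ih.add_const 1)

/-- Tracking from index `n` involves only erasers of index at least `n + 1`, and a limsup is
measurable whether or not the ratios converge. -/
theorem measurable_limitPos {Ω : Type*} (η : (n : ℕ) → Ω → Fin (n + 1)) (n i : ℕ) :
    Measurable[eraserFuture η n] fun ω => limitPos (fun m => η m ω) n i := by
  let _ : MeasurableSpace Ω := eraserFuture η n
  refine Measurable.limsup fun k => Measurable.div_const ?_ _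
  exact measurable_from_top.comp (measurable_trackedPos η n i k)

theorem trackedPos_ranks {x : ℕ → ℝ} (hx : Function.Injective x) {n j : ℕ} (hj : j ≤ n) (k : ℕ) :
    trackedPos (fun m => lastRank x m) n (rankAt x n j) k = rankAt x (n + k) j := by
  induction k with
  | zero => rfl
  | succ k ih => rw [trackedPos, ih, ← add_assoc, rankAt_succ hx (by omega)]

/-- Strong law of large numbers for the indicators of `[0, q]`. -/
theorem tendsto_card_le_div (q : unitInterval) :
    ∀ᵐ u ∂uniformSeq, Filter.Tendsto
      (fun m : ℕ => (((Finset.range m).filter fun k => u k ≤ q).card : ℝ) / m)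
      Filter.atTop (nhds (q : ℝ)) := by
  let g : unitInterval → ℝ := (Set.Iic q).indicator 1
  have hg : Measurable g := measurable_one.indicator measurableSet_Iic
  have hgi : Integrable g volume := (integrable_const 1).indicator measurableSet_Iic
  have hev := fun i : ℕ =>
    measurePreserving_eval_infinitePi (fun _ : ℕ => (volume : Measure unitInterval)) i
  have hint : Integrable (fun u : ℕ → unitInterval => g (u 0)) uniformSeq :=
    (hev 0).integrable_comp_of_integrable hgi
  have hind : Pairwise fun i j => IndepFun (fun u : ℕ → unitInterval => g (u i))
      (fun u => g (u j)) uniformSeq := fun i j hij =>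
    (iIndepFun_infinitePi (P := fun _ : ℕ => (volume : Measure unitInterval))
      (X := fun _ x => g x) fun _ => hg).indepFun hij
  have hid : ∀ i, IdentDistrib (fun u : ℕ → unitInterval => g (u i)) (fun u => g (u 0))
      uniformSeq uniformSeq := fun i =>
    IdentDistrib.comp (u := g) ⟨(hev i).measurable.aemeasurable, (hev 0).measurable.aemeasurable,
      (hev i).map_eq.trans (hev 0).map_eq.symm⟩ hg
  have hval : ∫ u, g (u 0) ∂uniformSeq = q := by
    calc ∫ u, g (u 0) ∂uniformSeq = ∫ x, g x ∂(uniformSeq.map fun u => u 0) :=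
          (integral_map (measurable_pi_apply 0).aemeasurable hg.aestronglyMeasurable).symm
      _ = ∫ x, g x := by rw [show uniformSeq.map (fun u => u 0) = volume from (hev 0).map_eq]
      _ = _ := by
        rw [integral_indicator_one measurableSet_Iic, measureReal_def, unitInterval.volume_Iic,
          ENNReal.toReal_ofReal q.2.1]
  have h := strong_law_ae_real (fun i (u : ℕ → unitInterval) => g (u i)) hint hind hid
  rw [hval] at h
  filter_upwards [h] with u hu
  refine hu.congr fun m => ?_
  simp [g, Set.indicator_apply, Finset.sum_boole]

/-- The **Glivenko-Cantelli theorem** for relative ranks. -/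
theorem tendsto_rankAt_div :
    ∀ᵐ u ∂uniformSeq, ∀ j : ℕ, Filter.Tendsto
      (fun m : ℕ => (rankAt (fun k => (u k : ℝ)) m j : ℝ) / ((m : ℝ) + 1))
      Filter.atTop (nhds (u j : ℝ)) := by
  -- Countably many levels share one null set; the random level `u j` is then squeezed between
  -- rational ones by monotonicity.
  have h : ∀ᵐ u ∂uniformSeq, ∀ q : ℚ, ∀ hq : (q : ℝ) ∈ unitInterval, Filter.Tendsto
      (fun m : ℕ => (((Finset.range m).filter fun k => u k ≤ ⟨q, hq⟩).card : ℝ) / m)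
      Filter.atTop (nhds (q : ℝ)) := by
    simp only [ae_all_iff]
    exact fun q hq => tendsto_card_le_div ⟨q, hq⟩
  filter_upwards [h] with u hu j
  have hpos : ∀ m : ℕ, (0 : ℝ) < m + 1 := fun m => by positivity
  have hu' : ∀ q : ℚ, ∀ hq : (q : ℝ) ∈ unitInterval, Filter.Tendsto
      (fun m : ℕ => (((Finset.range (m + 1)).filter fun k => u k ≤ ⟨q, hq⟩).card : ℝ) /
        ((m : ℝ) + 1)) Filter.atTop (nhds (q : ℝ)) := fun q hq =>
    ((hu q hq).comp (Filter.tendsto_add_atTop_nat 1)).congr fun m => by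
      simp only [Function.comp, Nat.cast_add_one]
  refine tendsto_order.2 ⟨fun a ha => ?_, fun a ha => ?_⟩
  · rcases lt_or_ge a 0 with h0 | h0
    · exact Filter.Eventually.of_forall fun m => h0.trans_le (by positivity)
    · obtain ⟨q, haq, hqu⟩ := exists_rat_btwn ha
      have hq : (q : ℝ) ∈ unitInterval := ⟨h0.trans haq.le, hqu.le.trans (u j).2.2⟩
      filter_upwards [(hu' q hq).eventually_const_lt haq] with m hm
      refine hm.trans_le ((div_le_div_iff_of_pos_right (hpos m)).2 (Nat.cast_le.2
        (Finset.card_le_card fun k hk => ?_)))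
      rw [Finset.mem_filter] at hk ⊢
      exact ⟨hk.1, lt_of_le_of_lt (Subtype.coe_le_coe.2 hk.2) hqu⟩
  · rcases lt_or_ge 1 a with h1 | h1
    · refine Filter.Eventually.of_forall fun m => lt_of_le_of_lt ((div_le_one (hpos m)).2 ?_) h1
      have : rankAt (fun k => (u k : ℝ)) m j ≤ m + 1 :=
        (Finset.card_filter_le _ _).trans (Finset.card_range _).le
      exact_mod_cast this
    · obtain ⟨q, huq, hqa⟩ := exists_rat_btwn ha
      have hq : (q : ℝ) ∈ unitInterval := ⟨(u j).2.1.trans huq.le, hqa.le.trans h1⟩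
      filter_upwards [(hu' q hq).eventually_lt_const hqa] with m hm
      refine lt_of_le_of_lt ((div_le_div_iff_of_pos_right (hpos m)).2 (Nat.cast_le.2
        (Finset.card_le_card fun k hk => ?_))) hm
      rw [Finset.mem_filter] at hk ⊢
      exact ⟨hk.1, Subtype.coe_le_coe.1 (hk.2.trans huq).le⟩

/-- The letter at position `i` belongs to the `i`-th smallest term, its tracked position is the rank
of that term, and rank over length tends to the value of the term. -/
theorem ae_limitPos_ranks :
    ∀ᵐ u ∂uniformSeq, ∀ n, ∀ i : Fin (n + 1),
      limitPos (fun m => ranks m u) n i =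
        u (Tuple.sort (fun i : Fin (n + 1) => (u i : ℝ)) i) := by
  filter_upwards [tendsto_rankAt_div, ae_injective_uniformSeq] with u hu hinj n i
  set j : Fin (n + 1) := Tuple.sort (fun i : Fin (n + 1) => (u i : ℝ)) i
  have hj : rankAt (fun k => (u k : ℝ)) n j = i := rankAt_sort hinj i
  refine Filter.Tendsto.limsup_eq ?_
  have h := (hu j).comp (Filter.tendsto_add_atTop_nat n)
  refine h.congr fun k => ?_
  rw [← hj]
  have h2 := trackedPos_ranks hinj (Nat.lt_succ_iff.1 j.2) k
  simp only [Function.comp, add_comm k n]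
  rw [← h2]
  rfl

variable {A : Type*} [MeasurableSpace A] [StandardBorelSpace A]

theorem isGeneratedByEraser_of_law_eq_glLaw {Ω : Type*} [MeasurableSpace Ω]
    {W : (n : ℕ) → Ω → (Fin (n + 1) → A)} {η : (n : ℕ) → Ω → Fin (n + 1)} {μ : Measure Ω}
    (hW : ∀ n, Measurable (W n)) (hη : ∀ n, Measurable (η n))
    {ρ : ProbabilityMeasure (A × ℝ)} {f : unitInterval → A} (hf : Measurable f)
    (hρ : (ρ : Measure (A × ℝ)) = (volume : Measure unitInterval).map fun u => (f u, (u : ℝ)))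
    (hlaw : law W η μ = glLaw ρ) : IsGeneratedByEraser W η μ := by
  -- `limitPos` is only known to lie in the unit interval almost surely, so `f` is extended to the
  -- line by projection.
  let F : ℝ → A := fun t => f (Set.projIcc 0 1 zero_le_one t)
  have hF : Measurable F := hf.comp continuous_projIcc.measurable
  have hword : ∀ n, ∀ᵐ ω ∂μ, W n ω = fun i : Fin (n + 1) => F (limitPos (fun m => η m ω) n i) := by
    intro n
    have hle : eraserFuture (fun n (p : Path A) => (p n).2) n ≤ MeasurableSpace.pi :=
      iSup₂_le fun k _ => ((measurable_pi_apply k).snd).comap_le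
    have hset : MeasurableSet {p : Path A |
        (p n).1 = fun i : Fin (n + 1) => F (limitPos (fun m => (p m).2) n i)} := by
      let _ := upgradeStandardBorel (Fin (n + 1) → A)
      exact measurableSet_eq_fun (measurable_pi_apply n).fst
        (measurable_pi_lambda _ fun i => hF.comp
          ((measurable_limitPos (fun n (p : Path A) => (p n).2) n i).mono hle le_rfl))
    have h1 : ∀ᵐ p ∂glLaw ρ, (p n).1 = fun i : Fin (n + 1) =>
        F (limitPos (fun m => (p m).2) n i) := by
      rw [glLaw_eq_map_uniformSeq hf hρ]
      refine (ae_map_iff (measurable_pathOf.comp (measurable_graph_seq hf)).aemeasurable hset).2 ?_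
      filter_upwards [ae_limitPos_ranks] with u hu
      ext i
      have h2 : F (limitPos (fun m => ranks m u) n i) =
          f (u (Tuple.sort (fun i : Fin (n + 1) => (u i : ℝ)) i)) := by
        rw [hu n i]
        exact congrArg f (Set.projIcc_val _ _)
      exact h2.symm
    rw [← hlaw] at h1
    exact ae_of_ae_map (measurable_pi_lambda _ fun n => (hW n).prodMk (hη n)).aemeasurable h1
  have hmono : ∀ n k, n ≤ k → eraserFuture η k ≤ eraserFuture η n := fun n k hnk =>
    iSup₂_le fun l hl => le_iSup₂_of_le
      (f := fun k (_ : n + 1 ≤ k) => MeasurableSpace.comap (η k) inferInstance) l (by omega) le_rfl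
  intro n
  constructor
  · have hle : backwardFiltration W η n ≤
        eventuallyMeasurableSpace (eraserFuture η n) (ae μ) := by
      refine iSup₂_le fun k hk => sup_le ?_ ?_
      · rintro _ ⟨s, hs, rfl⟩
        refine ⟨(fun ω (i : Fin (k + 1)) => F (limitPos (fun m => η m ω) k i)) ⁻¹' s,
          hmono n k hk _ ?_, ?_⟩
        · exact @measurable_pi_lambda Ω (Fin (k + 1)) (fun _ => A) (eraserFuture η k) _ _
            (fun i => hF.comp (measurable_limitPos η k i)) s hs
        · refine Filter.eventuallyEq_set.2 ?_
          filter_upwards [hword k] with ω hω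
          simp only [Set.mem_preimage, hω]
      · refine le_trans ?_ (fun s hs => hs.eventuallyMeasurableSet)
        exact le_iSup₂_of_le
          (f := fun k (_ : n + 1 ≤ k) => MeasurableSpace.comap (η k) inferInstance)
          (k + 1) (by omega) le_rfl
    intro s hs
    obtain ⟨t, ht, hst⟩ := hle s hs
    exact ⟨t, ht, measure_symmDiff_eq_zero_iff.2 hst⟩
  · exact fun s hs => ⟨s, eraserFuture_le_backwardFiltration W η n s hs, by simp⟩

end Backward

end ErasedWord

theorem mainTheorem5 {A Ω : Type*} [MeasurableSpace A] [StandardBorelSpace A]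
    [MeasurableSpace Ω] (μ : Measure Ω) [IsProbabilityMeasure μ]
    (W : (n : ℕ) → Ω → (Fin (n + 1) → A)) (η : (n : ℕ) → Ω → Fin (n + 1))
    (hWη : ErasedWord.IsErgodicGEWP W η μ) :
    ErasedWord.IsGeneratedByEraser W η μ ↔
      ∃ ρ ∈ ErasedWord.copulaSpace A,
        (∃ f : unitInterval → A, Measurable f ∧
          (ρ : Measure (A × ℝ)) =
            (volume : Measure unitInterval).map (fun u => (f u, (u : ℝ)))) ∧
        ErasedWord.law W η μ = ErasedWord.glLaw ρ := by
  refine ⟨hWη.1.exists_glLaw_eq, ?_⟩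
  rintro ⟨ρ, -, ⟨f, hf, hρ⟩, hlaw⟩
  exact ErasedWord.isGeneratedByEraser_of_law_eq_glLaw hWη.1.measurable_word
    hWη.1.measurable_eraser hf hρ hlaw
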